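/- For $(c,d),(c',d')\in\mathbb N^2$ say that $(c,d)$ properly divides $(c',d')$ if [$c=c'=0$ or $c<c'$] and [$d=d'=0$ or $d<d'$], and write $(c,d)\le(c',d')$ if $(c,d)=(c',d')$ or $(c,d)$ properly divides $(c',d')$. For $a,b\in\mathbb N$ let $P(a,b)=\{p\in\mathbb N^2 : p\le (a,b)\}$, a partially ordered set with least element $(0,0)$ and greatest element $(a,b)$. Let $\Delta(P(a,b))$ be its order complex, that is, the simplicial complex of all chains in $P(a,b)\setminus\{(0,0),(a,b)\}$, let $H_i(\,\cdot\,;\mathbb Z)$ denote (non-reduced) simplicial homology, and put $$t_{(a,b)}=\max\{\, i : H_i(\Delta(P(a,b));\mathbb Z)\neq 0 \,\},$$ with $t_{(a,b)}=-1$ if $H_i(\Delta(P(a,b));\mathbb Z)=0$ for all $i\ge 0$. **Proposition 3.6 (Bounds on homology).** Let $a,b$ be integers with $4\le a\le b$. If $2a-3k-2\le b\le 2a-3k$ for some integer $k\ge 1$, then $t_{(a,b)}=a-2-k$. -/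

import Mathlib

open CategoryTheory

namespace ProperDivision

/-! ### The poset of proper divisibility -/

/-- Exponent vectors of monomials in two variables. -/
@[ext]
structure Expo where
  fst : ℕ
  snd : ℕ

/-- `p` properly divides `q`: in each coordinate either both entries vanish or the entry of `p`
is strictly smaller. -/
def ProperlyDivides (p q : Expo) : Prop :=
  ((p.fst = 0 ∧ q.fst = 0) ∨ p.fst < q.fst) ∧ ((p.snd = 0 ∧ q.snd = 0) ∨ p.snd < q.snd)

/-- The order by proper divisibility: `p ≤ q` iff `p = q` or `p` properly divides `q`. -/
instance : PartialOrder Expo where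
  le p q := p = q ∨ ProperlyDivides p q
  le_refl p := Or.inl rfl
  le_trans p q r h₁ h₂ := by
    rcases h₁ with rfl | h₁
    · exact h₂
    · rcases h₂ with rfl | h₂
      · exact Or.inr h₁
      · right
        unfold ProperlyDivides at *
        omega
  le_antisymm p q h₁ h₂ := by
    rcases h₁ with rfl | h₁
    · rfl
    · rcases h₂ with rfl | h₂
      · rfl
      · unfold ProperlyDivides at *
        ext <;> omega

instance : OrderBot Expo where
  bot := ⟨0, 0⟩
  bot_le p := by
    right
    show ((0 = 0 ∧ p.fst = 0) ∨ 0 < p.fst) ∧ ((0 = 0 ∧ p.snd = 0) ∨ 0 < p.snd)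
    omega

/-- The poset `P(a,b)` of all exponent vectors below `(a,b)`. Its least element is `(0,0)`, its
greatest element is `(a,b)`. -/
abbrev P (a b : ℕ) : Type := Set.Iic (Expo.mk a b)

/-! ### Order complexes -/

/-- The elements of a bounded poset other than its least and its greatest element. -/
abbrev ProperPart (α : Type) [PartialOrder α] [BoundedOrder α] : Type :=
  {p : α // p ≠ ⊥ ∧ p ≠ ⊤}

/-- The simplicial complex of all nonempty finite chains of a poset. -/
def chainsComplex (α : Type) [PartialOrder α] : AbstractSimplicialComplex α where
  faces := {s | s.Nonempty ∧ IsChain (· ≤ ·) (s : Set α)}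
  isRelLowerSet_faces := fun _ hs =>
    ⟨hs.1, fun _ hts ht => ⟨ht, hs.2.mono (Finset.coe_subset.mpr hts)⟩⟩
  singleton_mem := fun v => ⟨Finset.singleton_nonempty v, by simp⟩

/-- The order complex `Δ(P)` of a bounded poset `P`: the chains of `P` without its least and its
greatest element. -/
def orderComplex (α : Type) [PartialOrder α] [BoundedOrder α] :
    AbstractSimplicialComplex (ProperPart α) :=
  chainsComplex (ProperPart α)

/-! ### Simplicial homology with integer coefficients

The simplicial chain complex of a simplicial complex `K` is formed with respect to a partial order
of the vertices that is total on every face, so that every face is oriented by listing its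
vertices increasingly. -/

section Homology

variable {V : Type} [PartialOrder V] (K : AbstractSimplicialComplex V)

/-- The vertices of every face are totally ordered. -/
def IsOrdered : Prop := ∀ s ∈ K, IsChain (· ≤ ·) (s : Set V)

/-- The faces of dimension `n`. -/
abbrev Simplex (n : ℕ) : Type := {s : Finset V // s ∈ K ∧ s.card = n + 1}

/-- The group of simplicial `n`-chains: the free abelian group on the `n`-dimensional faces. -/
abbrev Chains (n : ℕ) : Type := Simplex K n →₀ ℤ

variable {K}

open scoped Classical in
/-- The facet of a simplex obtained by omitting the vertex `v`. -/
noncomputable def Simplex.facet {n : ℕ} (s : Simplex K (n + 1)) (v : s.1) : Simplex K n :=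
  ⟨s.1.erase v, by
    have hc : (s.1.erase v).card = n + 1 := by
      rw [Finset.card_erase_of_mem v.2, s.2.2]; rfl
    refine ⟨(K.isRelLowerSet_faces s.2.1).2 (Finset.erase_subset _ _) ?_, hc⟩
    exact Finset.card_pos.mp (by omega)⟩

open scoped Classical in
/-- The position of the vertex `v` when the vertices of `s` are listed increasingly, counted
from `0`. -/
noncomputable def position (s : Finset V) (v : V) : ℕ := (s.filter (· < v)).card

variable (K)

/-- The boundary map: a face `{v₀ < ⋯ < vₙ₊₁}` is sent to the sum over `i` of `(-1) ^ i` times the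
face with the vertex `vᵢ` omitted. -/
noncomputable def boundary (n : ℕ) : Chains K (n + 1) →ₗ[ℤ] Chains K n :=
  Finsupp.linearCombination ℤ fun s : Simplex K (n + 1) =>
    ∑ v : s.1, (-1 : ℤ) ^ position s.1 v • Finsupp.single (s.facet v) (1 : ℤ)

variable {K}

theorem boundary_single {n : ℕ} (s : Simplex K (n + 1)) :
    boundary K n (Finsupp.single s 1) =
      ∑ v : s.1, (-1 : ℤ) ^ position s.1 v • Finsupp.single (s.facet v) (1 : ℤ) := by
  simp [boundary]

open scoped Classical in
theorem position_erase_of_lt {s : Finset V} {v w : V} (hv : v ∈ s) (h : v < w) :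
    position s w = position (s.erase v) w + 1 := by
  unfold position
  rw [Finset.filter_erase, Finset.card_erase_add_one (Finset.mem_filter.mpr ⟨hv, h⟩)]

open scoped Classical in
theorem position_erase_of_not_lt {s : Finset V} {v w : V} (h : ¬ v < w) :
    position (s.erase v) w = position s w := by
  unfold position
  rw [Finset.filter_erase, Finset.erase_eq_of_notMem (by simp [h])]

theorem boundary_comp_boundary (hK : IsOrdered K) (n : ℕ) :
    boundary K n ∘ₗ boundary K (n + 1) = 0 := by
  classical
  refine Finsupp.lhom_ext' fun s => LinearMap.ext_ring ?_
  simp only [LinearMap.comp_apply, Finsupp.lsingle_apply, boundary_single, map_sum, map_smul,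
    LinearMap.zero_apply, Finset.smul_sum]
  rw [Finset.sum_sigma']
  have hne : ∀ x : (v : s.1) × (s.facet v).1, x.2.1 ≠ x.1.1 := fun x =>
    (Finset.mem_erase.mp x.2.2).1
  have hmem : ∀ x : (v : s.1) × (s.facet v).1, x.2.1 ∈ s.1 := fun x =>
    (Finset.mem_erase.mp x.2.2).2
  refine Finset.sum_involution
    (fun x _ => ⟨⟨x.2.1, hmem x⟩, ⟨x.1.1, Finset.mem_erase.mpr ⟨(hne x).symm, x.1.2⟩⟩⟩) ?_ ?_
    (fun _ _ => by simp) (fun _ _ => rfl)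
  · rintro ⟨v, w⟩ -
    have hf : (s.facet ⟨w.1, hmem ⟨v, w⟩⟩).facet
          ⟨v.1, Finset.mem_erase.mpr ⟨(hne ⟨v, w⟩).symm, v.2⟩⟩ = (s.facet v).facet w :=
      Subtype.ext (Finset.erase_right_comm)
    have hw : w.1 ∈ s.1 := hmem ⟨v, w⟩
    have hvw : w.1 ≠ v.1 := hne ⟨v, w⟩
    dsimp only
    rw [hf, smul_smul, smul_smul, ← add_smul]
    convert zero_smul ℤ _
    change (-1 : ℤ) ^ position s.1 v.1 * (-1) ^ position (s.1.erase v.1) w.1 +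
      (-1) ^ position s.1 w.1 * (-1) ^ position (s.1.erase w.1) v.1 = 0
    rcases hK s.1 s.2.1 v.2 hw hvw.symm with h | h
    · have h' : v.1 < w.1 := lt_of_le_of_ne h hvw.symm
      rw [position_erase_of_lt v.2 h', position_erase_of_not_lt h'.not_gt]
      ring
    · have h' : w.1 < v.1 := lt_of_le_of_ne h hvw
      rw [position_erase_of_lt hw h', position_erase_of_not_lt h'.not_gt]
      ring
  · rintro x - - h
    exact hne x (congrArg (fun y => y.1.1) h)

variable (K)

/-- The simplicial chain complex of `K` with integer coefficients. -/
noncomputable def simplicialChainComplex (hK : IsOrdered K) : ChainComplex (ModuleCat.{0} ℤ) ℕ :=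
  ChainComplex.of (fun n => ModuleCat.of ℤ (Chains K n))
    (fun n => ModuleCat.ofHom (boundary K n))
    (fun n => by
      rw [← ModuleCat.ofHom_comp, boundary_comp_boundary hK n, ModuleCat.ofHom_zero])

/-- The (non-reduced) simplicial homology group `H_i(K; ℤ)`. -/
noncomputable def simplicialHomology (hK : IsOrdered K) (i : ℕ) : ModuleCat.{0} ℤ :=
  (simplicialChainComplex K hK).homology i

end Homology

theorem isOrdered_orderComplex (α : Type) [PartialOrder α] [BoundedOrder α] :
    IsOrdered (orderComplex α) := fun _ hs => hs.2

/-- `H_i(Δ(P(a,b)); ℤ)`. -/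
noncomputable def homologyP (a b i : ℕ) : ModuleCat.{0} ℤ :=
  simplicialHomology (orderComplex (P a b)) (isOrdered_orderComplex (P a b)) i

/-- The degrees in which the homology of `Δ(P(a,b))` does not vanish. -/
def nonvanishingDegrees (a b : ℕ) : Set ℤ :=
  {i | ∃ n : ℕ, i = n ∧ Nontrivial (homologyP a b n)}

open scoped Classical in
/-- `t_{(a,b)}`, the largest degree with nonvanishing homology, and `-1` if there is none. -/
noncomputable def t (a b : ℕ) : ℤ :=
  if h : ∃ m, IsGreatest (nonvanishingDegrees a b) m then h.choose else -1

/-- A nonnegative value of `t` really is the largest element of the set of degrees. -/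
theorem t_eq_natCast_iff (a b n : ℕ) :
    t a b = n ↔ IsGreatest (nonvanishingDegrees a b) (n : ℤ) := by
  unfold t
  constructor
  · intro h
    split_ifs at h with h'
    exact h ▸ h'.choose_spec
  · intro h
    have h' : ∃ m, IsGreatest (nonvanishingDegrees a b) m := ⟨_, h⟩
    rw [dif_pos h']
    exact h'.choose_spec.unique h

end ProperDivision

namespace ProperDivision

/-! ### Augmented chains and the cone homotopy. -/

section AugmentedChains

open scoped Classical

variable {V : Type}

/-! The top degree is found from two independent bounds, both in terms of reduced homology indexed
by the number `j` of vertices (so degree `j - 1`).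

Vanishing: adjoining a vertex creates no homology at `j + 1` if its link has none at `j`
(`acyclic_insert`). In a quadrant of the grid, the corner is a cone point for everything strictly
above it in both coordinates. What remains is the row and the column through the corner, and the
link of such a point is a smaller quadrant whose two side lengths have dropped by at least 1 and 2.
Hence each degree costs 3 (`acyclic_quadrant`). Treating the points near the axes separately gives
vanishing in degree `j` once `a + b - 4 < 3 * j` (`acyclic_univ_of_lt`).

Nonvanishing: a staircase with steps (1,2) and (2,1) can be a maximal chain. Lowering each of its
points by 1 in a suitable coordinate gives a second point for each level, and the pairs span a
cross-polytope. Its fundamental cycle has a nonzero coefficient on the staircase, while no boundary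
can, since the staircase is a facet of no larger chain (`not_acyclic_univ`).

The inequalities on `b` make the two bounds meet at degree `a - 2 - k`. -/

theorem supported_map_mem {A : Set (Finset V)} {M : Type*} [AddCommGroup M]
    (f : (Finset V →₀ ℤ) →ₗ[ℤ] M) (N : Submodule ℤ M)
    (h : ∀ s ∈ A, f (Finsupp.single s 1) ∈ N) {z : Finset V →₀ ℤ}
    (hz : z ∈ Finsupp.supported ℤ ℤ A) : f z ∈ N := by
  rw [Finsupp.supported_eq_span_single] at hz
  have : Submodule.span ℤ ((fun i => Finsupp.single i (1 : ℤ)) '' A) ≤ N.comap f := by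
    rw [Submodule.span_le]
    rintro _ ⟨s, hs, rfl⟩
    exact h s hs
  exact this hz

theorem supported_map_eq {A : Set (Finset V)} {M : Type*} [AddCommGroup M]
    (f g : (Finset V →₀ ℤ) →ₗ[ℤ] M)
    (h : ∀ s ∈ A, f (Finsupp.single s 1) = g (Finsupp.single s 1)) {z : Finset V →₀ ℤ}
    (hz : z ∈ Finsupp.supported ℤ ℤ A) : f z = g z := by
  have := supported_map_mem (f - g) ⊥ (fun s hs => by simp [h s hs]) hz
  rw [Submodule.mem_bot, LinearMap.sub_apply, sub_eq_zero] at this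
  exact this

variable [PartialOrder V]

/-- The augmented boundary map on all finite sets of vertices. -/
noncomputable def augBoundary : (Finset V →₀ ℤ) →ₗ[ℤ] (Finset V →₀ ℤ) :=
  Finsupp.linearCombination ℤ fun s : Finset V =>
    ∑ v ∈ s, (-1 : ℤ) ^ position s v • Finsupp.single (s.erase v) (1 : ℤ)

/-- The cone operator with apex `v`; faces that contain `v` are sent to zero. -/
noncomputable def coneMap (v : V) : (Finset V →₀ ℤ) →ₗ[ℤ] (Finset V →₀ ℤ) :=
  Finsupp.linearCombination ℤ fun s : Finset V =>
    if v ∈ s then 0 else (-1 : ℤ) ^ position s v • Finsupp.single (insert v s) (1 : ℤ)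

theorem augBoundary_single (s : Finset V) :
    augBoundary (Finsupp.single s 1) =
      ∑ v ∈ s, (-1 : ℤ) ^ position s v • Finsupp.single (s.erase v) (1 : ℤ) := by
  simp [augBoundary]

theorem coneMap_single_of_mem {v : V} {s : Finset V} (h : v ∈ s) :
    coneMap v (Finsupp.single s 1) = 0 := by
  simp [coneMap, h]

theorem coneMap_single_of_notMem {v : V} {s : Finset V} (h : v ∉ s) :
    coneMap v (Finsupp.single s 1) =
      (-1 : ℤ) ^ position s v • Finsupp.single (insert v s) (1 : ℤ) := by
  simp [coneMap, h]

theorem coneMap_homotopy_single_of_notMem {v : V} {s : Finset V} (hv : v ∉ s)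
    (h : IsChain (· ≤ ·) (insert v (s : Set V))) :
    augBoundary (coneMap v (Finsupp.single s 1)) + coneMap v (augBoundary (Finsupp.single s 1)) =
      Finsupp.single s 1 := by
  have hp : position (insert v s) v = position s v := by
    have := position_erase_of_not_lt (s := insert v s) (lt_irrefl v)
    rw [Finset.erase_insert hv] at this
    exact this.symm
  rw [coneMap_single_of_notMem hv, map_smul, augBoundary_single, augBoundary_single,
    Finset.sum_insert hv, map_sum, smul_add, Finset.smul_sum, hp, Finset.erase_insert hv,
    smul_smul, ← mul_pow, neg_one_mul, neg_neg, one_pow, one_smul, add_assoc,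
    ← Finset.sum_add_distrib]
  convert add_zero _
  refine Finset.sum_eq_zero fun w hw => ?_
  have hwv : w ≠ v := fun e => hv (e ▸ hw)
  have hv' : v ∉ s.erase w := fun h => hv (Finset.mem_of_mem_erase h)
  rw [map_smul, coneMap_single_of_notMem hv', smul_smul, smul_smul,
    Finset.erase_insert_of_ne hwv.symm, ← add_smul]
  convert zero_smul ℤ _
  have hpi : position s w = position ((insert v s).erase v) w := by
    rw [Finset.erase_insert hv]
  rcases h (Set.mem_insert_of_mem _ hw) (Set.mem_insert v _) hwv with hlt | hlt
  · have hlt' : w < v := lt_of_le_of_ne hlt hwv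
    rw [position_erase_of_lt hw hlt', hpi, position_erase_of_not_lt hlt'.not_gt]
    ring
  · have hlt' : v < w := lt_of_le_of_ne hlt hwv.symm
    rw [position_erase_of_not_lt hlt'.not_gt, hpi,
      position_erase_of_lt (Finset.mem_insert_self v s) hlt']
    ring

theorem coneMap_homotopy_single_of_mem {v : V} {s : Finset V} (hv : v ∈ s) :
    coneMap v (augBoundary (Finsupp.single s 1)) = Finsupp.single s 1 := by
  rw [augBoundary_single, map_sum, Finset.sum_eq_single_of_mem v hv]
  · rw [map_smul, coneMap_single_of_notMem (Finset.notMem_erase v s), smul_smul,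
      position_erase_of_not_lt (lt_irrefl v), ← mul_pow, neg_one_mul, neg_neg, one_pow, one_smul,
      Finset.insert_erase hv]
  · intro w _ hwv
    rw [map_smul, coneMap_single_of_mem (Finset.mem_erase.mpr ⟨hwv.symm, hv⟩), smul_zero]

/-- The chain homotopy that contracts a cone. Simplices that already contain the apex are covered
because `coneMap` kills them and the face opposite to the apex restores them. -/
theorem coneMap_homotopy {v : V} {z : Finset V →₀ ℤ}
    (hz : z ∈ Finsupp.supported ℤ ℤ {s : Finset V | IsChain (· ≤ ·) (insert v (s : Set V))}) :
    augBoundary (coneMap v z) + coneMap v (augBoundary z) = z := by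
  refine supported_map_eq (augBoundary ∘ₗ coneMap v + coneMap v ∘ₗ augBoundary) LinearMap.id
    (fun s hs => ?_) hz
  simp only [LinearMap.add_apply, LinearMap.comp_apply, LinearMap.id_apply]
  by_cases hv : v ∈ s
  · rw [coneMap_single_of_mem hv, map_zero, zero_add, coneMap_homotopy_single_of_mem hv]
  · exact coneMap_homotopy_single_of_notMem hv hs

/-- The augmented chains on the faces with `j` vertices, all of them in `S`. -/
def chainsOn (S : Set V) (j : ℕ) : Submodule ℤ (Finset V →₀ ℤ) :=
  Finsupp.supported ℤ ℤ {s : Finset V | ↑s ⊆ S ∧ IsChain (· ≤ ·) (s : Set V) ∧ s.card = j}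

theorem chainsOn_mono {S T : Set V} (h : S ⊆ T) (j : ℕ) : chainsOn S j ≤ chainsOn T j :=
  Finsupp.supported_mono fun _ hs => ⟨hs.1.trans h, hs.2⟩

theorem single_mem_chainsOn {S : Set V} {j : ℕ} {s : Finset V} (hs : ↑s ⊆ S)
    (hc : IsChain (· ≤ ·) (s : Set V)) (hj : s.card = j) :
    Finsupp.single s (1 : ℤ) ∈ chainsOn S j :=
  Finsupp.single_mem_supported ℤ _ ⟨hs, hc, hj⟩

theorem augBoundary_mem_chainsOn {S : Set V} {j : ℕ} {z : Finset V →₀ ℤ}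
    (hz : z ∈ chainsOn S (j + 1)) : augBoundary z ∈ chainsOn S j := by
  refine supported_map_mem _ _ (fun s hs => ?_) hz
  rw [augBoundary_single]
  refine Submodule.sum_mem _ fun v hv => Submodule.smul_mem _ _ ?_
  have hsub : ((s.erase v : Finset V) : Set V) ⊆ s := Finset.coe_subset.mpr (Finset.erase_subset _ _)
  exact single_mem_chainsOn (hsub.trans hs.1) (hs.2.1.mono hsub)
    (by rw [Finset.card_erase_of_mem hv, hs.2.2, Nat.add_sub_cancel])

theorem coneMap_mem_chainsOn {S : Set V} {v : V} (hv : ∀ w ∈ S, w ≤ v ∨ v ≤ w) {j : ℕ}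
    {z : Finset V →₀ ℤ} (hz : z ∈ chainsOn S j) : coneMap v z ∈ chainsOn (insert v S) (j + 1) := by
  refine supported_map_mem _ _ (fun s hs => ?_) hz
  by_cases h : v ∈ s
  · rw [coneMap_single_of_mem h]; exact Submodule.zero_mem _
  · rw [coneMap_single_of_notMem h]
    refine Submodule.smul_mem _ _ (single_mem_chainsOn ?_ ?_ ?_)
    · rw [Finset.coe_insert]; exact Set.insert_subset_insert hs.1
    · rw [Finset.coe_insert]
      exact hs.2.1.insert fun w hw _ => (hv w (hs.1 hw)).symm
    · rw [Finset.card_insert_of_notMem h, hs.2.2]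

theorem chainsOn_le_coneable {S : Set V} {v : V} (hv : ∀ w ∈ S, w ≤ v ∨ v ≤ w) (j : ℕ) :
    chainsOn S j ≤
      Finsupp.supported ℤ ℤ {s : Finset V | IsChain (· ≤ ·) (insert v (s : Set V))} :=
  Finsupp.supported_mono fun _ hs => hs.2.1.insert fun w hw _ => (hv w (hs.1 hw)).symm

/-- Up to sign, `insert v s` is the cone over `s`. Applying the boundary to the homotopy identity
for `s`, and using the identity for its boundary, leaves exactly the double boundary of this cone.
Being a chain matters: signs need not cancel on other sets. -/
theorem augBoundary_augBoundary_single (s : Finset V) (hs : IsChain (· ≤ ·) (s : Set V)) :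
    augBoundary (augBoundary (Finsupp.single s 1)) = 0 := by
  induction s using Finset.induction_on with
  | empty => simp [augBoundary_single]
  | insert v s hv ih =>
    rw [Finset.coe_insert] at hs
    have hs' : IsChain (· ≤ ·) (s : Set V) := hs.mono (Set.subset_insert _ _)
    have hcomp : ∀ w ∈ (s : Set V), w ≤ v ∨ v ≤ w := fun w hw =>
      hs.total (Set.mem_insert_of_mem _ hw) (Set.mem_insert _ _)
    have hsm : Finsupp.single s (1 : ℤ) ∈ chainsOn (s : Set V) s.card :=
      single_mem_chainsOn subset_rfl hs' rfl
    have h1 := coneMap_homotopy (chainsOn_le_coneable hcomp _ hsm)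
    have h2 : augBoundary (coneMap v (augBoundary (Finsupp.single s 1))) =
        augBoundary (Finsupp.single s 1) := by
      rcases Nat.eq_zero_or_pos s.card with h0 | h0
      · rw [Finset.card_eq_zero.mp h0]; simp [augBoundary_single]
      · obtain ⟨j, hj⟩ := Nat.exists_eq_succ_of_ne_zero h0.ne'
        rw [hj] at hsm
        have := coneMap_homotopy (chainsOn_le_coneable hcomp _ (augBoundary_mem_chainsOn hsm))
        rwa [ih hs', map_zero, add_zero] at this
    have h3 := congrArg augBoundary h1
    rw [map_add, h2, add_eq_right, coneMap_single_of_notMem hv, map_smul, map_smul] at h3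
    exact (smul_eq_zero.mp h3).resolve_left (pow_ne_zero _ (by norm_num))

theorem augBoundary_augBoundary {S : Set V} {j : ℕ} {z : Finset V →₀ ℤ} (hz : z ∈ chainsOn S j) :
    augBoundary (augBoundary z) = 0 := by
  have h : (augBoundary ∘ₗ augBoundary) z = (0 : (Finset V →₀ ℤ) →ₗ[ℤ] (Finset V →₀ ℤ)) z := by
    refine supported_map_eq _ _ (fun s hs => ?_) hz
    rw [LinearMap.comp_apply, LinearMap.zero_apply]
    exact augBoundary_augBoundary_single s hs.2.1
  exact h

/-! ### Acyclicity and attaching vertices along links. -/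

/-- The reduced homology of the order complex of `S` vanishes at the faces with `j` vertices,
that is, in degree `j - 1`. -/
def Acyclic (S : Set V) (j : ℕ) : Prop :=
  ∀ z ∈ chainsOn S j, augBoundary z = 0 → ∃ w ∈ chainsOn S (j + 1), augBoundary w = z

theorem acyclic_of_cone {S : Set V} {v : V} (hvS : v ∈ S) (hv : ∀ w ∈ S, w ≤ v ∨ v ≤ w) (j : ℕ) :
    Acyclic S j := by
  intro z hz h0
  refine ⟨coneMap v z, ?_, ?_⟩
  · have := coneMap_mem_chainsOn hv hz
    rwa [Set.insert_eq_of_mem hvS] at this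
  · have := coneMap_homotopy (chainsOn_le_coneable hv _ hz)
    rwa [h0, map_zero, add_zero] at this

theorem acyclic_empty (j : ℕ) : Acyclic (∅ : Set V) (j + 1) := by
  intro z hz _
  refine ⟨0, Submodule.zero_mem _, ?_⟩
  rw [map_zero]
  refine (supported_map_eq LinearMap.id 0 (fun s hs => ?_) hz).symm
  have : s = ∅ := by simpa using hs.1
  simp [this] at hs

/-- The vertices of the link of `v` in `S`. -/
def linkIn (S : Set V) (v : V) : Set V := {w ∈ S | w < v ∨ v < w}

/-- The Mayer–Vietoris argument for attaching a cone over the link, carried out on cycles. -/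
theorem acyclic_insert {S : Set V} {v : V} {j : ℕ} (hS : Acyclic S (j + 1))
    (hl : Acyclic (linkIn S v) j) : Acyclic (insert v S) (j + 1) := by
  by_cases hvS : v ∈ S
  · rwa [Set.insert_eq_of_mem hvS]
  intro z hz h0
  set A := z.filter (fun s => v ∈ s) with hA
  set B := z.filter (fun s => ¬ v ∈ s) with hB
  have hAB : A + B = z := Finsupp.filter_add_filter_not z _
  have hAz : A ∈ Finsupp.supported ℤ ℤ {s : Finset V | v ∈ s ∧ ↑s ⊆ insert v S ∧
      IsChain (· ≤ ·) (s : Set V) ∧ s.card = j + 1} := by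
    rw [Finsupp.mem_supported]
    intro s hs
    rw [Finset.mem_coe, hA, Finsupp.support_filter, Finset.mem_filter] at hs
    exact ⟨hs.2, (Finsupp.mem_supported ℤ z).mp hz hs.1⟩
  have hBz : B ∈ chainsOn S (j + 1) := by
    rw [chainsOn, Finsupp.mem_supported]
    intro s hs
    rw [Finset.mem_coe, hB, Finsupp.support_filter, Finset.mem_filter] at hs
    have := (Finsupp.mem_supported ℤ z).mp hz hs.1
    refine ⟨fun w hw => (this.1 hw).resolve_left ?_, this.2⟩
    rintro rfl
    exact hs.2 hw
  have hAc : A ∈ chainsOn (insert v S) (j + 1) := Finsupp.supported_mono (fun s hs => hs.2) hAz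
  have hcone : coneMap v (augBoundary A) = A :=
    supported_map_eq (coneMap v ∘ₗ augBoundary) LinearMap.id
      (fun s hs => coneMap_homotopy_single_of_mem hs.1) hAz
  have hbd : augBoundary A = - augBoundary B := by
    rw [← hAB, map_add] at h0
    exact eq_neg_of_add_eq_zero_left h0
  -- The boundary of `A` avoids `v` because that of `B` does, and its faces are comparable with `v`
  -- because those of `A` contain `v`.
  have hbA : augBoundary A ∈ chainsOn (linkIn S v) j := by
    have h1 : augBoundary A ∈ chainsOn S j := by
      rw [hbd]; exact Submodule.neg_mem _ (augBoundary_mem_chainsOn hBz)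
    have h2 : augBoundary A ∈ Finsupp.supported ℤ ℤ
        {s : Finset V | ∀ w ∈ s, w ≤ v ∨ v ≤ w} := by
      refine supported_map_mem _ _ (fun s hs => ?_) hAz
      rw [augBoundary_single]
      refine Submodule.sum_mem _ fun u _ => Submodule.smul_mem _ _
        (Finsupp.single_mem_supported ℤ _ fun w hw => ?_)
      exact hs.2.2.1.total (Finset.mem_of_mem_erase hw) hs.1
    rw [chainsOn, Finsupp.mem_supported]
    intro s hs
    have h3 := (Finsupp.mem_supported ℤ _).mp h1 hs
    have h4 := (Finsupp.mem_supported ℤ _).mp h2 hs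
    refine ⟨fun w hw => ⟨h3.1 hw, ?_⟩, h3.2⟩
    have hne : w ≠ v := fun e => hvS (e ▸ h3.1 hw)
    exact (h4 w hw).imp (fun h => lt_of_le_of_ne h hne) (fun h => lt_of_le_of_ne h hne.symm)
  obtain ⟨w, hw, hwA⟩ := hl _ hbA (augBoundary_augBoundary hAc)
  -- The cone over the filling `w` has boundary `w - A`. It thus replaces `A` by `w`, and `B + w` is
  -- a cycle inside `S`.
  have hcomp : ∀ u ∈ linkIn S v, u ≤ v ∨ v ≤ u := fun u hu => hu.2.imp le_of_lt le_of_lt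
  have hhom := coneMap_homotopy (chainsOn_le_coneable hcomp _ hw)
  rw [hwA, hcone] at hhom
  have hlS : linkIn S v ⊆ S := fun _ h => h.1
  have hBw : B + w ∈ chainsOn S (j + 1) := Submodule.add_mem _ hBz (chainsOn_mono hlS _ hw)
  obtain ⟨y, hy, hyB⟩ := hS _ hBw (by rw [map_add, hwA, hbd, add_neg_cancel])
  refine ⟨y - coneMap v w, Submodule.sub_mem _ (chainsOn_mono (Set.subset_insert _ _) _ hy)
    (chainsOn_mono (Set.insert_subset_insert hlS) _ (coneMap_mem_chainsOn hcomp hw)), ?_⟩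
  rw [map_sub, hyB, eq_sub_of_add_eq hhom, ← hAB]
  abel

/-- The vertices of `T` are attached one by one; quantifying over all `T' ⊆ T` makes the order of
attachment irrelevant. -/
theorem acyclic_union {S T : Set V} (hT : T.Finite) {j : ℕ} (hS : Acyclic S (j + 1))
    (hl : ∀ v ∈ T, ∀ T' ⊆ T, Acyclic (linkIn (S ∪ T') v) j) : Acyclic (S ∪ T) (j + 1) := by
  induction T, hT using Set.Finite.induction_on with
  | empty => rwa [Set.union_empty]
  | @insert v T _ _ ih =>
    rw [Set.union_insert]
    refine acyclic_insert (ih fun u hu T' hT' => hl u (Set.mem_insert_of_mem _ hu) T'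
      (hT'.trans (Set.subset_insert _ _))) (hl v (Set.mem_insert _ _) T (Set.subset_insert _ _))

/-! ### Comparison with simplicial homology -/

/-! ### Maximal chains and cross-polytope cycles. -/

theorem augBoundary_apply_eq_zero_of_maximal {S : Set V} {j : ℕ} {w : Finset V →₀ ℤ}
    (hw : w ∈ chainsOn S j) {σ : Finset V}
    (hσ : ∀ q ∈ S, (∀ p ∈ σ, p ≤ q ∨ q ≤ p) → q ∈ σ) : augBoundary w σ = 0 := by
  refine supported_map_eq (Finsupp.lapply σ ∘ₗ augBoundary) 0 (fun s hs => ?_) hw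
  rw [LinearMap.comp_apply, augBoundary_single, map_sum, LinearMap.zero_apply]
  refine Finset.sum_eq_zero fun v hv => ?_
  have hne : s.erase v ≠ σ := by
    rintro rfl
    refine Finset.notMem_erase v s (hσ v (hs.1 hv) fun p hp => ?_)
    exact hs.2.1.total (Finset.mem_of_mem_erase hp) hv
  simp [Finsupp.single_eq_of_ne' hne]

theorem coneMap_apply_of_notMem {v : V} {σ : Finset V} (hv : v ∉ σ) (z : Finset V →₀ ℤ) :
    coneMap v z σ = 0 := by
  have hz : z ∈ Finsupp.supported ℤ ℤ (Set.univ : Set (Finset V)) := by simp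
  refine supported_map_eq (Finsupp.lapply σ ∘ₗ coneMap v) 0 (fun s _ => ?_) hz
  by_cases h : v ∈ s
  · simp [coneMap_single_of_mem h]
  · have : insert v s ≠ σ := fun e => hv (e ▸ Finset.mem_insert_self v s)
    simp [coneMap_single_of_notMem h, Finsupp.single_eq_of_ne' this]

theorem coneMap_apply_insert {v : V} {σ : Finset V} (hv : v ∉ σ) (z : Finset V →₀ ℤ) :
    coneMap v z (insert v σ) = (-1) ^ position σ v * z σ := by
  have hz : z ∈ Finsupp.supported ℤ ℤ (Set.univ : Set (Finset V)) := by simp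
  refine supported_map_eq (Finsupp.lapply (insert v σ) ∘ₗ coneMap v)
    ((-1 : ℤ) ^ position σ v • Finsupp.lapply σ) (fun s _ => ?_) hz
  by_cases h : v ∈ s
  · have : s ≠ σ := fun e => hv (e ▸ h)
    simp [coneMap_single_of_mem h, Finsupp.single_eq_of_ne' this]
  · by_cases he : s = σ
    · subst he; simp [coneMap_single_of_notMem h]
    · have : insert v s ≠ insert v σ := fun e => he (by
        rw [← Finset.erase_insert h, e, Finset.erase_insert hv])
      simp [coneMap_single_of_notMem h, Finsupp.single_eq_of_ne' this, Finsupp.single_eq_of_ne' he]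

/-- A sequence of pairs of vertices, each pair below the next one, spans a cross-polytope, whose
fundamental cycle has a nonzero coefficient at the first vertices of the pairs. -/
theorem exists_crossPolytope_cycle (p q : ℕ → V) (n : ℕ) (hne : ∀ i < n, p i ≠ q i)
    (hlt : ∀ i, i + 1 < n →
      p i < p (i + 1) ∧ p i < q (i + 1) ∧ q i < p (i + 1) ∧ q i < q (i + 1)) :
    ∃ z ∈ chainsOn {v | ∃ i < n, v = p i ∨ v = q i} n,
      augBoundary z = 0 ∧ z ((Finset.range n).image p) ≠ 0 := by
  induction n with
  | zero =>
    refine ⟨Finsupp.single ∅ 1, single_mem_chainsOn (by simp) (by simp) (by simp), ?_, by simp⟩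
    simp [augBoundary_single]
  | succ n ih =>
    obtain ⟨z, hz, hbz, hz0⟩ := ih (fun i hi => hne i (hi.trans n.lt_succ_self))
      (fun i hi => hlt i (hi.trans n.lt_succ_self))
    have hbelow : ∀ i < n, p i < p n ∧ p i < q n ∧ q i < p n ∧ q i < q n := by
      intro i hi
      induction n, hi using Nat.le_induction with
      | base => exact hlt i (Nat.lt_succ_self _)
      | succ m hm _ =>
        have key : ∀ l, i + 1 ≤ l → l < m + 1 + 1 →
            p i < p l ∧ p i < q l ∧ q i < p l ∧ q i < q l := by
          intro l hl
          induction l, hl using Nat.le_induction with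
          | base => exact fun h => hlt i h
          | succ l _ ihl =>
            intro h
            have h1 := ihl (by omega)
            have h2 := hlt l h
            exact ⟨h1.1.trans h2.1, h1.1.trans h2.2.1, h1.2.2.1.trans h2.1, h1.2.2.1.trans h2.2.1⟩
        exact key (m + 1) (by omega) (by omega)
    set S : Set V := {v | ∃ i < n, v = p i ∨ v = q i}
    have hp : ∀ w ∈ S, w < p n := by
      rintro w ⟨i, hi, rfl | rfl⟩
      exacts [(hbelow i hi).1, (hbelow i hi).2.2.1]
    have hq : ∀ w ∈ S, w < q n := by
      rintro w ⟨i, hi, rfl | rfl⟩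
      exacts [(hbelow i hi).2.1, (hbelow i hi).2.2.2]
    have hp' : ∀ w ∈ S, w ≤ p n ∨ p n ≤ w := fun w hw => Or.inl (hp w hw).le
    have hq' : ∀ w ∈ S, w ≤ q n ∨ q n ≤ w := fun w hw => Or.inl (hq w hw).le
    have hsub : S ⊆ {v | ∃ i < n + 1, v = p i ∨ v = q i} := fun v ⟨i, hi, h⟩ => ⟨i, by omega, h⟩
    -- Suspension of `z`: each cone has boundary `z`, so the difference is a cycle. Only the cone
    -- with apex `p n` contributes to the simplex of all `p i`.
    refine ⟨coneMap (p n) z - coneMap (q n) z, Submodule.sub_mem _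
      (chainsOn_mono (Set.insert_subset ?_ hsub) _ (coneMap_mem_chainsOn hp' hz))
      (chainsOn_mono (Set.insert_subset ?_ hsub) _ (coneMap_mem_chainsOn hq' hz)), ?_, ?_⟩
    · exact ⟨n, n.lt_succ_self, Or.inl rfl⟩
    · exact ⟨n, n.lt_succ_self, Or.inr rfl⟩
    · have h1 := coneMap_homotopy (chainsOn_le_coneable hp' _ hz)
      have h2 := coneMap_homotopy (chainsOn_le_coneable hq' _ hz)
      rw [hbz, map_zero, add_zero] at h1 h2
      rw [map_sub, h1, h2, sub_self]
    · have hpn : p n ∉ (Finset.range n).image p := by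
        intro h
        obtain ⟨i, hi, he⟩ := Finset.mem_image.mp h
        exact (hbelow i (Finset.mem_range.mp hi)).1.ne he
      have hqn : q n ∉ insert (p n) ((Finset.range n).image p) := by
        intro h
        rcases Finset.mem_insert.mp h with h | h
        · exact hne n n.lt_succ_self h.symm
        · obtain ⟨i, hi, he⟩ := Finset.mem_image.mp h
          exact (hbelow i (Finset.mem_range.mp hi)).2.1.ne he
      rw [Finset.range_add_one, Finset.image_insert, Finsupp.sub_apply,
        coneMap_apply_of_notMem hqn, sub_zero, coneMap_apply_insert hpn]
      exact mul_ne_zero (pow_ne_zero _ (by norm_num)) hz0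

end AugmentedChains

end ProperDivision

namespace ProperDivision

/-! ### Comparison of augmented chains with simplicial homology. -/

section Comparison

open scoped Classical

variable {V : Type} [PartialOrder V]

theorem mem_chainsComplex_of_card {s : Finset V} {n : ℕ} (hs : IsChain (· ≤ ·) (s : Set V))
    (hc : s.card = n + 1) : s ∈ chainsComplex V :=
  ⟨Finset.card_pos.mp (by omega), hs⟩

/-- Simplicial chains of the order complex, as augmented chains. -/
noncomputable def toAug (n : ℕ) : Chains (chainsComplex V) n →ₗ[ℤ] (Finset V →₀ ℤ) :=
  Finsupp.lmapDomain ℤ ℤ Subtype.val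

theorem toAug_single {n : ℕ} (s : Simplex (chainsComplex V) n) :
    toAug n (Finsupp.single s 1) = Finsupp.single s.1 1 := by
  simp [toAug]

theorem toAug_injective (n : ℕ) : Function.Injective (toAug (V := V) n) :=
  Finsupp.mapDomain_injective Subtype.val_injective

theorem toAug_boundary {n : ℕ} (x : Chains (chainsComplex V) (n + 1)) :
    toAug n (boundary _ n x) = augBoundary (toAug (n + 1) x) := by
  have : toAug n ∘ₗ boundary (chainsComplex V) n = augBoundary ∘ₗ toAug (n + 1) := by
    refine Finsupp.lhom_ext' fun s => LinearMap.ext_ring ?_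
    simp only [LinearMap.comp_apply, Finsupp.lsingle_apply, boundary_single, toAug_single,
      augBoundary_single, map_sum, map_smul]
    exact Finset.sum_coe_sort s.1
      (fun v => (-1 : ℤ) ^ position s.1 v • Finsupp.single (s.1.erase v) (1 : ℤ))
  exact LinearMap.congr_fun this x

theorem range_toAug (n : ℕ) : LinearMap.range (toAug (V := V) n) = chainsOn Set.univ (n + 1) := by
  rw [chainsOn, Finsupp.supported_eq_span_single]
  apply le_antisymm
  · rintro _ ⟨x, rfl⟩
    induction x using Finsupp.induction_linear with
    | zero => rw [map_zero]; exact Submodule.zero_mem _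
    | add x y hx hy => rw [map_add]; exact Submodule.add_mem _ hx hy
    | single s c =>
      rw [← mul_one c, ← smul_eq_mul, ← Finsupp.smul_single, map_smul, toAug_single]
      exact Submodule.smul_mem _ _
        (Submodule.subset_span ⟨s.1, ⟨Set.subset_univ _, s.2.1.2, s.2.2⟩, rfl⟩)
  · rw [Submodule.span_le]
    rintro _ ⟨s, hs, rfl⟩
    exact ⟨Finsupp.single ⟨s, mem_chainsComplex_of_card hs.2.1 hs.2.2, hs.2.2⟩ 1, toAug_single _⟩

/-- Restricted to positive degree, where reduced and non-reduced homology agree; degree `n + 1`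
means `n + 2` vertices. -/
theorem acyclic_univ_iff (n : ℕ) : Acyclic (Set.univ : Set V) (n + 2) ↔
    ∀ x : Chains (chainsComplex V) (n + 1), boundary _ n x = 0 →
      ∃ y, boundary _ (n + 1) y = x := by
  constructor
  · intro h x hx
    obtain ⟨w, hw, hwx⟩ := h (toAug (n + 1) x)
      (by rw [← range_toAug]; exact LinearMap.mem_range_self _ _)
      (by rw [← toAug_boundary, hx, map_zero])
    rw [← range_toAug] at hw
    obtain ⟨y, rfl⟩ := hw
    exact ⟨y, toAug_injective _ (by rw [toAug_boundary, hwx])⟩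
  · intro h z hz h0
    rw [← range_toAug] at hz
    obtain ⟨x, rfl⟩ := hz
    obtain ⟨y, rfl⟩ := h x (toAug_injective _ (by rw [toAug_boundary, h0, map_zero]))
    exact ⟨toAug (n + 2) y, by rw [← range_toAug]; exact LinearMap.mem_range_self _ _,
      (toAug_boundary y).symm⟩

theorem nontrivial_simplicialHomology_succ_iff (K : AbstractSimplicialComplex V)
    (hK : IsOrdered K) (n : ℕ) : Nontrivial (simplicialHomology K hK (n + 1)) ↔
      ¬ ∀ x : Chains K (n + 1), boundary K n x = 0 → ∃ y, boundary K (n + 1) y = x := by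
  rw [← not_subsingleton_iff_nontrivial, not_iff_not, ← ModuleCat.isZero_iff_subsingleton,
    simplicialHomology, ← HomologicalComplex.exactAt_iff_isZero_homology,
    HomologicalComplex.exactAt_iff' _ (n + 2) (n + 1) n (by simp) (by simp),
    ShortComplex.moduleCat_exact_iff]
  have h1 : (simplicialChainComplex K hK).d (n + 2) (n + 1) =
      ModuleCat.ofHom (boundary K (n + 1)) :=
    ChainComplex.of_d (fun n => ModuleCat.of ℤ (Chains K n))
      (fun n => ModuleCat.ofHom (boundary K n)) (n + 1)
  have h2 : (simplicialChainComplex K hK).d (n + 1) n =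
      ModuleCat.ofHom (boundary K n) :=
    ChainComplex.of_d (fun n => ModuleCat.of ℤ (Chains K n))
      (fun n => ModuleCat.ofHom (boundary K n)) n
  simp only [HomologicalComplex.shortComplexFunctor'_obj_f, HomologicalComplex.sc',
    HomologicalComplex.shortComplexFunctor'_obj_g, h1, h2]
  rfl

end Comparison

theorem nontrivial_homologyP_succ_iff (a b n : ℕ) : Nontrivial (homologyP a b (n + 1)) ↔
    ¬ Acyclic (Set.univ : Set (ProperPart (P a b))) (n + 2) := by
  rw [acyclic_univ_iff]
  exact nontrivial_simplicialHomology_succ_iff _ _ n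

/-! ### Vanishing of homology above the bound. -/

section Grid

variable {a b : ℕ}

theorem fst_lt (ha : 0 < a) (p : ProperPart (P a b)) : p.1.1.fst < a := by
  rcases p.1.2 with h | h
  · exact absurd (Subtype.ext h) p.2.2
  · rcases h.1 with h | h <;> omega

theorem snd_lt (hb : 0 < b) (p : ProperPart (P a b)) : p.1.1.snd < b := by
  rcases p.1.2 with h | h
  · exact absurd (Subtype.ext h) p.2.2
  · rcases h.2 with h | h <;> omega

theorem fst_pos_or_snd_pos (p : ProperPart (P a b)) : 0 < p.1.1.fst ∨ 0 < p.1.1.snd := by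
  by_contra! h
  exact p.2.1 (Subtype.ext (Expo.ext (Nat.le_zero.mp h.1) (Nat.le_zero.mp h.2)))

theorem exists_properPart {x y : ℕ} (hx : x < a) (hy : y < b) (h0 : 0 < x ∨ 0 < y) :
    ∃ p : ProperPart (P a b), p.1.1.fst = x ∧ p.1.1.snd = y := by
  refine ⟨⟨⟨⟨x, y⟩, Or.inr ⟨Or.inr hx, Or.inr hy⟩⟩, ?_, ?_⟩, rfl, rfl⟩
  · intro h
    have h1 : x = 0 := congrArg (fun p : P a b => p.1.fst) h
    have h2 : y = 0 := congrArg (fun p : P a b => p.1.snd) h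
    omega
  · intro h
    exact hx.ne (congrArg (fun p : P a b => p.1.fst) h)

theorem properPart_ext {p q : ProperPart (P a b)} (h1 : p.1.1.fst = q.1.1.fst)
    (h2 : p.1.1.snd = q.1.1.snd) : p = q :=
  Subtype.ext (Subtype.ext (Expo.ext h1 h2))

theorem properPart_lt_iff {p q : ProperPart (P a b)} : p < q ↔
    ((p.1.1.fst = 0 ∧ q.1.1.fst = 0) ∨ p.1.1.fst < q.1.1.fst) ∧
      ((p.1.1.snd = 0 ∧ q.1.1.snd = 0) ∨ p.1.1.snd < q.1.1.snd) := by
  constructor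
  · intro h
    rcases h.le with h' | h'
    · exact absurd (Subtype.ext (Subtype.ext h')) h.ne
    · exact h'
  · intro h
    have h0 := fst_pos_or_snd_pos p
    refine lt_of_le_of_ne (show p.1.1 = q.1.1 ∨ ProperlyDivides p.1.1 q.1.1 from Or.inr h) ?_
    rintro rfl
    omega

/-- The part of the open interval strictly above `c` and strictly to the right of `d`. -/
def quadrant (a b c d : ℕ) : Set (ProperPart (P a b)) := {p | c < p.1.1.fst ∧ d < p.1.1.snd}

theorem finite_properPart (ha : 0 < a) (hb : 0 < b) : Finite (ProperPart (P a b)) := by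
  refine Finite.of_injective
    (fun p : ProperPart (P a b) =>
      ((⟨p.1.1.fst, fst_lt ha p⟩, ⟨p.1.1.snd, snd_lt hb p⟩) : Fin a × Fin b)) ?_
  intro p q h
  simp only [Prod.mk.injEq, Fin.mk.injEq] at h
  exact properPart_ext h.1 h.2

theorem acyclic_quadrant (ha : 0 < a) (hb : 0 < b) (j : ℕ) : ∀ c d : ℕ,
    (a - 1 - c) + (b - 1 - d) < 3 * j → Acyclic (quadrant a b c d) j := by
  have := finite_properPart ha hb
  induction j with
  | zero => intro c d h; omega
  | succ j ih =>
    intro c d h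
    by_cases hne : c + 1 < a ∧ d + 1 < b
    · obtain ⟨v, hv1, hv2⟩ := exists_properPart hne.1 hne.2 (by omega)
      set T : Set (ProperPart (P a b)) :=
        {p | (p.1.1.fst = c + 1 ∧ d + 1 < p.1.1.snd) ∨ (c + 1 < p.1.1.fst ∧ p.1.1.snd = d + 1)}
        with hT
      -- The corner `v` is the least element of the cone, and `T` is the rest of its row and column.
      have hu : quadrant a b c d = insert v (quadrant a b (c + 1) (d + 1)) ∪ T := by
        ext p
        have hpv : p = v ↔ p.1.1.fst = c + 1 ∧ p.1.1.snd = d + 1 :=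
          ⟨fun h => by rw [h]; exact ⟨hv1, hv2⟩,
            fun h => properPart_ext (h.1.trans hv1.symm) (h.2.trans hv2.symm)⟩
        simp only [quadrant, hT, Set.mem_union, Set.mem_insert_iff, Set.mem_ofPred_eq, hpv]
        omega
      rw [hu]
      refine acyclic_union T.toFinite (acyclic_of_cone (Set.mem_insert _ _) ?_ _) ?_
      · rintro w (rfl | hw)
        · exact Or.inl le_rfl
        · refine Or.inr (le_of_lt (properPart_lt_iff.mpr ?_))
          simp only [quadrant, Set.mem_ofPred_eq] at hw
          omega
      · intro p hp T' hT'
        have hl : linkIn (insert v (quadrant a b (c + 1) (d + 1)) ∪ T') p =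
            quadrant a b p.1.1.fst p.1.1.snd := by
          ext w
          simp only [hT, Set.mem_ofPred_eq] at hp
          have hwv : w = v → w.1.1.fst = c + 1 ∧ w.1.1.snd = d + 1 := fun h => by
            rw [h]; exact ⟨hv1, hv2⟩
          have hwT : w ∈ T' → _ := fun h => hT' h
          simp only [hT, Set.mem_ofPred_eq] at hwT
          simp only [linkIn, quadrant, Set.mem_union, Set.mem_insert_iff, Set.mem_ofPred_eq,
            properPart_lt_iff]
          constructor
          · rintro ⟨(hw | hw) | hw, hc⟩
            · have := hwv hw; omega
            · omega
            · have := hwT hw; omega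
          · intro hw
            exact ⟨Or.inl (Or.inr (by omega)), by omega⟩
        rw [hl]
        -- One side shrinks by exactly 1 and the other by at least 2, which pays for lowering `j` by
        -- one.
        refine ih _ _ ?_
        have h1 := fst_lt ha p
        have h2 := snd_lt hb p
        simp only [hT, Set.mem_ofPred_eq] at hp
        omega
    · have he : quadrant a b c d = ∅ := by
        refine Set.eq_empty_of_forall_notMem fun p hp => hne ?_
        have h1 := fst_lt ha p
        have h2 := snd_lt hb p
        exact ⟨lt_of_le_of_lt hp.1 h1, lt_of_le_of_lt hp.2 h2⟩
      rw [he]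
      exact acyclic_empty j

/-- The points (1,1), (1,0), (0,1) are the minimal ones that see all of `X`: the first makes a cone
over `X`, the other two have link `X`. All remaining points have contractible links and do not
affect the homology. -/
theorem acyclic_univ_of_lt (ha : 1 < a) (hb : 1 < b) {j : ℕ} (h : (a - 2) + (b - 2) < 3 * j) :
    Acyclic (Set.univ : Set (ProperPart (P a b))) (j + 1) := by
  have := finite_properPart (a := a) (b := b) (by omega) (by omega)
  obtain ⟨o, ho1, ho2⟩ := exists_properPart ha hb (by omega)
  obtain ⟨u, hu1, hu2⟩ := exists_properPart (x := 1) (y := 0) ha (show 0 < b by omega) (by omega)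
  obtain ⟨v, hv1, hv2⟩ := exists_properPart (x := 0) (y := 1) (show 0 < a by omega) hb (by omega)
  set X := quadrant a b 1 1 with hX
  have hXj : Acyclic X j := acyclic_quadrant (by omega) (by omega) j 1 1 (by omega)
  have h1 : Acyclic (insert o X ∪ {u, v}) (j + 1) := by
    refine acyclic_union (Set.toFinite _) (acyclic_of_cone (Set.mem_insert _ _) ?_ _) ?_
    · rintro w (rfl | hw)
      · exact Or.inl le_rfl
      · refine Or.inr (le_of_lt (properPart_lt_iff.mpr ?_))
        simp only [hX, quadrant, Set.mem_ofPred_eq] at hw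
        omega
    · intro p hp T' hT'
      have hp' : (p.1.1.fst = 1 ∧ p.1.1.snd = 0) ∨ (p.1.1.fst = 0 ∧ p.1.1.snd = 1) := by
        rcases hp with rfl | rfl <;> omega
      have hl : linkIn (insert o X ∪ T') p = X := by
        ext w
        simp only [linkIn, hX, quadrant, Set.mem_union, Set.mem_insert_iff, Set.mem_ofPred_eq,
          properPart_lt_iff]
        constructor
        · rintro ⟨(rfl | hw) | hw, hc⟩
          · omega
          · omega
          · rcases hT' hw with rfl | rfl <;> omega
        · intro hw
          exact ⟨Or.inl (Or.inr hw), by omega⟩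
      rwa [hl]
  rw [← Set.union_compl_self (insert o X ∪ {u, v})]
  refine acyclic_union (Set.toFinite _) h1 fun p hp T' _ => ?_
  have hp0 := fst_pos_or_snd_pos p
  have hpX : ¬ (1 < p.1.1.fst ∧ 1 < p.1.1.snd) := fun h => hp (Or.inl (Or.inr h))
  have hpo : ¬ (p.1.1.fst = 1 ∧ p.1.1.snd = 1) := fun h =>
    hp (Or.inl (Or.inl (properPart_ext (h.1.trans ho1.symm) (h.2.trans ho2.symm))))
  have hpu : ¬ (p.1.1.fst = 1 ∧ p.1.1.snd = 0) := fun h =>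
    hp (Or.inr (Or.inl (properPart_ext (h.1.trans hu1.symm) (h.2.trans hu2.symm))))
  have hpv : ¬ (p.1.1.fst = 0 ∧ p.1.1.snd = 1) := fun h =>
    hp (Or.inr (Or.inr (properPart_ext (h.1.trans hv1.symm) (h.2.trans hv2.symm))))
  have hcase : (p.1.1.snd ≤ 1 ∧ 2 ≤ p.1.1.fst) ∨ (p.1.1.fst ≤ 1 ∧ 2 ≤ p.1.1.snd) := by omega
  rcases hcase with hc | hc
  -- Below `p` there are only points on the first axis, where (1,0) is least because two zero
  -- entries count as comparable; everything above `p` is above (1,0) too. So `u` is a cone point of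
  -- the link.
  · have hmem : u ∈ linkIn (insert o X ∪ {u, v} ∪ T') p := by
      refine ⟨Or.inl (Or.inr (Or.inl rfl)), ?_⟩
      rw [properPart_lt_iff, properPart_lt_iff]; omega
    refine acyclic_of_cone hmem ?_ j
    rintro w ⟨-, hw⟩
    have hw0 := fst_pos_or_snd_pos w
    by_cases hwu : w = u
    · exact Or.inl hwu.le
    · refine Or.inr (le_of_lt (properPart_lt_iff.mpr ?_))
      have : ¬ (w.1.1.fst = 1 ∧ w.1.1.snd = 0) := fun h =>
        hwu (properPart_ext (h.1.trans hu1.symm) (h.2.trans hu2.symm))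
      rw [properPart_lt_iff, properPart_lt_iff] at hw
      omega
  · have hmem : v ∈ linkIn (insert o X ∪ {u, v} ∪ T') p := by
      refine ⟨Or.inl (Or.inr (Or.inr rfl)), ?_⟩
      rw [properPart_lt_iff, properPart_lt_iff]; omega
    refine acyclic_of_cone hmem ?_ j
    rintro w ⟨-, hw⟩
    have hw0 := fst_pos_or_snd_pos w
    by_cases hwv : w = v
    · exact Or.inl hwv.le
    · refine Or.inr (le_of_lt (properPart_lt_iff.mpr ?_))
      have : ¬ (w.1.1.fst = 0 ∧ w.1.1.snd = 1) := fun h =>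
        hwv (properPart_ext (h.1.trans hv1.symm) (h.2.trans hv2.symm))
      rw [properPart_lt_iff, properPart_lt_iff] at hw
      omega

end Grid

end ProperDivision

/-! ### Nonvanishing from a maximal staircase. -/

namespace ProperDivision

open scoped Classical in
-- A boundary has coefficient zero on a maximal chain, whereas the fundamental cycle does not.
theorem not_acyclic_of_maximal_crossPolytope {V : Type} [PartialOrder V] (p q : ℕ → V) (n : ℕ)
    (hne : ∀ i < n, p i ≠ q i)
    (hlt : ∀ i, i + 1 < n →
      p i < p (i + 1) ∧ p i < q (i + 1) ∧ q i < p (i + 1) ∧ q i < q (i + 1))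
    (hmax : ∀ v : V, (∀ i < n, p i ≤ v ∨ v ≤ p i) → ∃ i < n, p i = v) :
    ¬ Acyclic (Set.univ : Set V) n := by
  intro h
  obtain ⟨z, hz, hbz, hz0⟩ := exists_crossPolytope_cycle p q n hne hlt
  obtain ⟨w, hw, rfl⟩ := h z (chainsOn_mono (Set.subset_univ _) n hz) hbz
  refine hz0 (augBoundary_apply_eq_zero_of_maximal hw fun v _ hv => ?_)
  obtain ⟨i, hi, rfl⟩ := hmax v fun i hi =>
    hv _ (Finset.mem_image_of_mem p (Finset.mem_range.mpr hi))
  exact Finset.mem_image_of_mem p (Finset.mem_range.mpr hi)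

/-- The staircase with `α` steps `(1,2)` followed by `β` steps `(2,1)` from `(1,1)` is a maximal
chain of the open interval if a final step `(1,·)` leads to the top. -/
theorem not_acyclic_univ {a b α β : ℕ} (ha : a = α + 2 * β + 2) (hb : 2 * α + β + 2 ≤ b) :
    ¬ Acyclic (Set.univ : Set (ProperPart (P a b))) (α + β + 1) := by
  -- The truncated difference `i - α` counts the steps (2,1) made so far. Beyond the staircase the
  -- value is arbitrary.
  have hp : ∀ i, ∃ p : ProperPart (P a b), i < α + β + 1 →
      p.1.1.fst = 1 + i + (i - α) ∧ p.1.1.snd + (i - α) = 1 + 2 * i := by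
    intro i
    by_cases hi : i < α + β + 1
    · obtain ⟨p, h1, h2⟩ := exists_properPart (a := a) (b := b) (x := 1 + i + (i - α))
        (y := 1 + 2 * i - (i - α)) (by omega) (by omega) (by omega)
      exact ⟨p, fun _ => by omega⟩
    · obtain ⟨p, -⟩ := exists_properPart (a := a) (b := b) (x := 1) (y := 0)
        (by omega) (by omega) (by omega)
      exact ⟨p, fun h => absurd h hi⟩
  -- For `i > 0` the partner lowers by 1 the coordinate in which the last step was 2, so it stays
  -- above the preceding pair. The partner of (1,1) is (0,1).
  have hq : ∀ i, ∃ q : ProperPart (P a b), i < α + β + 1 →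
      (i = 0 ∧ q.1.1.fst = 0 ∧ q.1.1.snd = 1) ∨
      (0 < i ∧ i ≤ α ∧ q.1.1.fst = 1 + i ∧ q.1.1.snd = 2 * i) ∨
      (0 < i ∧ α < i ∧ q.1.1.fst = i + (i - α) ∧ q.1.1.snd + (i - α) = 1 + 2 * i) := by
    intro i
    by_cases hi : i < α + β + 1
    · obtain ⟨q, h1, h2⟩ := exists_properPart (a := a) (b := b)
        (x := if i = 0 then 0 else if i ≤ α then 1 + i else i + (i - α))
        (y := if i = 0 then 1 else if i ≤ α then 2 * i else 1 + 2 * i - (i - α))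
        (by split_ifs <;> omega) (by split_ifs <;> omega) (by split_ifs <;> omega)
      refine ⟨q, fun _ => ?_⟩
      split_ifs at h1 h2 <;> omega
    · obtain ⟨q, -⟩ := exists_properPart (a := a) (b := b) (x := 1) (y := 0)
        (by omega) (by omega) (by omega)
      exact ⟨q, fun h => absurd h hi⟩
  choose p hp using hp
  choose q hq using hq
  refine not_acyclic_of_maximal_crossPolytope p q _ ?_ ?_ ?_
  · intro i hi h
    have h1 := hp i hi
    have h2 := hq i hi
    rw [← h] at h2
    omega
  · intro i hi
    have h1 := hp i (by omega)
    have h2 := hq i (by omega)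
    have h3 := hp (i + 1) hi
    have h4 := hq (i + 1) hi
    simp only [properPart_lt_iff]
    omega
  · intro v hv
    by_contra! hne
    have hlt : ∀ i < α + β + 1, p i < v ∨ v < p i := fun i hi =>
      (hv i hi).imp (fun h => lt_of_le_of_ne h (hne i hi))
        (fun h => lt_of_le_of_ne h (hne i hi).symm)
    simp only [properPart_lt_iff] at hlt
    have h0 := fst_pos_or_snd_pos v
    -- Only the excluded (0,0) lies below (1,1), and no point fits between consecutive stairs, as
    -- one coordinate rises by just 1. So `v` would lie above the last stair, whose first coordinate
    -- is already `a - 1`.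
    have key : ∀ i < α + β + 1, p i < v := by
      intro i
      induction i with
      | zero =>
        intro hi
        have h1 := hp 0 hi
        have h2 := hlt 0 hi
        rw [properPart_lt_iff]
        omega
      | succ i ih =>
        intro hi
        have h1 := hp i (by omega)
        have h2 := hp (i + 1) hi
        have h3 := hlt (i + 1) hi
        have h4 := ih (by omega)
        rw [properPart_lt_iff] at h4 ⊢
        omega
    have h1 := hp (α + β) (by omega)
    have h2 := key (α + β) (by omega)
    have h3 := fst_lt (by omega) v
    rw [properPart_lt_iff] at h2
    omega

end ProperDivision

theorem proposition3p6 (a b k : ℕ) (ha : 4 ≤ a) (hab : a ≤ b) (hk : 1 ≤ k)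
    (hlower : 2 * (a : ℤ) - 3 * k - 2 ≤ b) (hupper : (b : ℤ) ≤ 2 * a - 3 * k) :
    ProperDivision.t a b = (a : ℤ) - 2 - k := by
  -- The degree is positive because `3 * k ≤ a` and `4 ≤ a`; it is written as a successor to match
  -- the comparison with `Acyclic`.
  have hn : (a : ℤ) - 2 - k = ((a - 3 - k + 1 : ℕ) : ℤ) := by omega
  rw [hn, ProperDivision.t_eq_natCast_iff]
  constructor
  · refine ⟨_, rfl, ?_⟩
    rw [ProperDivision.nontrivial_homologyP_succ_iff]
    -- With `k` steps (2,1), the width `a` fixes `α`, and the height condition becomes `hlower`.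
    have h := ProperDivision.not_acyclic_univ (a := a) (b := b) (α := a - 2 * k - 2) (β := k)
      (by omega) (by omega)
    rwa [show a - 2 * k - 2 + k + 1 = a - 3 - k + 2 by omega] at h
  · rintro _ ⟨n, rfl, hnt⟩
    by_contra! hlt
    obtain ⟨n, rfl⟩ : ∃ m, n = m + 1 := ⟨n - 1, by omega⟩
    rw [ProperDivision.nontrivial_homologyP_succ_iff] at hnt
    -- A degree of at least `a - 1 - k` has triple at least `3 * a - 3 * k - 3`, which exceeds `a +
    -- b - 4` by `hupper`.
    exact hnt (ProperDivision.acyclic_univ_of_lt (by omega) (by omega) (by omega))
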